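/- Let $n\ge 0$ and let $\mathbf M\in\mathbb S^n_{++}$ be a real symmetric positive definite $n\times n$ matrix. For $\mathbf X\in\mathbb S^n_{++}$ and a symmetric matrix $\mathbf U$ let $\mathcal L_{\mathbf X,\mathbf M}[\mathbf U]$ be the unique symmetric solution $\mathbf S$ of $\mathbf X\mathbf S\mathbf M+\mathbf M\mathbf S\mathbf X=\mathbf U$. The generalized Bures–Wasserstein (GBW) metric is the Riemannian metric $g_{\mathbf X}(\mathbf U,\mathbf V)=\tfrac12\operatorname{tr}(\mathcal L_{\mathbf X,\mathbf M}[\mathbf U]\mathbf V)$ on the manifold $\mathbb S^n_{++}$ of symmetric positive definite matrices, whose tangent spaces are the space of symmetric matrices. Let $d_{\rm gbw}$ be its Riemannian distance (the infimum of the lengths of $C^1$ paths). Let $d_{\rm gl}$ be the Riemannian distance on $\mathrm{GL}(n)$, the open set of invertible real $n\times n$ matrices, for the Euclidean metric $\langle \mathbf U,\mathbf V\rangle_2=\operatorname{tr}(\mathbf U^\top\mathbf V)$ (with $d_{\rm gl}=\infty$ between different connected components), and let $\pi:\mathrm{GL}(n)\to\mathbb S^n_{++}$, $\pi(\mathbf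 P)=\mathbf M^{1/2}\mathbf P\mathbf P^\top\mathbf M^{1/2}$. Then for all $\mathbf X,\mathbf Y\in\mathbb S^n_{++}$ the following hold. 1. The distance is finite and $$d_{\rm gbw}(\mathbf X,\mathbf Y)=\Bigl(\operatorname{tr}(\mathbf M^{-1}\mathbf X)+\operatorname{tr}(\mathbf M^{-1}\mathbf Y)-2\operatorname{tr}\bigl((\mathbf X^{1/2}\mathbf M^{-1}\mathbf Y\mathbf M^{-1}\mathbf X^{1/2})^{1/2}\bigr)\Bigr)^{1/2},$$ where the expression under the outer root is nonnegative. 2. This number equals $d_{\rm bw}(\mathbf M^{-1/2}\mathbf X\mathbf M^{-1/2},\,\mathbf M^{-1/2}\mathbf Y\mathbf M^{-1/2})$, where $d_{\rm bw}(\mathbf A,\mathbf B)=\bigl(\operatorname{tr}\mathbf A+\operatorname{tr}\mathbf B-2\operatorname{tr}((\mathbf A^{1/2}\mathbf B\mathbf A^{1/2})^{1/2})\bigr)^{1/2}$ is the Bures–Wasserstein distance. 3. It is the quotient distance under $\pi$: $$d_{\rm gbw}(\mathbf X,\mathbf Y)=\inf_{\pi(\mathbf P)=\mathbf X,\ \pi(\mathbf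 Q)=\mathbf Y} d_{\rm gl}(\mathbf P,\mathbf Q)=\inf_{\pi(\mathbf P)=\mathbf X,\ \pi(\mathbf Q)=\mathbf Y}\|\mathbf P-\mathbf Q\|_2,$$ where $\mathbf P,\mathbf Q$ range over $\mathrm{GL}(n)$ and $\|\mathbf A\|_2=\operatorname{tr}(\mathbf A^\top\mathbf A)^{1/2}$. -/

import Mathlib

open scoped Manifold ContDiff ENNReal Bundle MatrixOrder

section OpenSubmanifold

/-! ### Riemannian metrics on open subsets of a finite-dimensional vector space

An open subset `U` of a normed space `E` is a manifold with the single chart `U ⊆ E`, so every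
tangent space of `U` is `E` itself. -/

variable {E : Type*} [NormedAddCommGroup E] [NormedSpace ℝ E] {U : TopologicalSpace.Opens E}

/-- A family of bilinear forms on `E`, read as a family of bilinear forms on the tangent spaces of
the open submanifold `U` of `E`. -/
def toTangentForm (g : U → E →L[ℝ] E →L[ℝ] ℝ) (x : U) :
    TangentSpace 𝓘(ℝ, E) x →L[ℝ] TangentSpace 𝓘(ℝ, E) x →L[ℝ] ℝ := g x

theorem opens_trivializationAt_symm (x y : U) (v : E) :
    (FiberBundle.trivializationAt E (TangentSpace 𝓘(ℝ, E)) x).symm y v = v := by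
  have hy : y ∈ (chartAt E x).source := mem_chart_source E y
  have := TangentBundle.symmL_trivializationAt_eq_core (I := 𝓘(ℝ, E)) hy
  rw [← Bundle.Trivialization.symmL_apply (R := ℝ) (hb := hy), this]
  exact (tangentBundleCore 𝓘(ℝ, E) U).coordChange_self _ _ (mem_chart_source E y) v

theorem contMDiff_toTangentForm (g : U → E →L[ℝ] E →L[ℝ] ℝ)
    (hg : ContMDiff 𝓘(ℝ, E) 𝓘(ℝ, E →L[ℝ] E →L[ℝ] ℝ) ∞ g) :
    ContMDiff 𝓘(ℝ, E) (𝓘(ℝ, E).prod 𝓘(ℝ, E →L[ℝ] E →L[ℝ] ℝ)) ∞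
      (fun x : U ↦ Bundle.TotalSpace.mk' (E →L[ℝ] E →L[ℝ] ℝ)
        (E := fun x : U ↦ TangentSpace 𝓘(ℝ, E) x →L[ℝ] TangentSpace 𝓘(ℝ, E) x →L[ℝ] ℝ)
        x (toTangentForm g x)) := by
  intro x
  rw [Bundle.contMDiffAt_section]
  refine (hg x).congr_of_eventuallyEq (Filter.Eventually.of_forall fun y => ?_)
  have hy : y ∈ (chartAt E x).source := mem_chart_source E y
  ext v w
  beta_reduce
  rw [hom_trivializationAt_apply]
  have := inCoordinates_apply_eq₂ (F₁ := E) (F₂ := E) (F₃ := ℝ) (𝕜 := ℝ)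
    (E₁ := fun x : U ↦ TangentSpace 𝓘(ℝ, E) x) (E₂ := fun x : U ↦ TangentSpace 𝓘(ℝ, E) x)
    (E₃ := Bundle.Trivial U ℝ) (x₀ := x) (x := y) (ϕ := toTangentForm g y) (v := v) (w := w)
    hy hy (by trivial)
  rw [opens_trivializationAt_symm, opens_trivializationAt_symm] at this
  refine this.trans ?_
  simp
  rfl

theorem isVonNBounded_of_posDef_form [FiniteDimensional ℝ E] (B : E →L[ℝ] E →L[ℝ] ℝ)
    (pos : ∀ v, v ≠ 0 → 0 < B v v) : Bornology.IsVonNBounded ℝ {v : E | B v v < 1} := by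
  rcases subsingleton_or_nontrivial E with hE | hE
  · exact (NormedSpace.isVonNBounded_iff ℝ).2 (Set.toFinite _).isBounded
  have hcont : Continuous fun v => B v v := B.continuous.clm_apply continuous_id
  obtain ⟨u, hu, hmin⟩ := (isCompact_sphere (0 : E) 1).exists_isMinOn
    (NormedSpace.sphere_nonempty.2 zero_le_one) hcont.continuousOn
  have hu0 : u ≠ 0 := by rintro rfl; simp at hu
  have hc := pos u hu0
  set c := B u u
  rw [NormedSpace.isVonNBounded_iff, isBounded_iff_forall_norm_le]
  refine ⟨√(1 / c), fun v (hv : B v v < 1) => ?_⟩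
  by_cases h0 : v = 0
  · simp [h0]
  have hn : 0 < ‖v‖ := norm_pos_iff.2 h0
  have h1 : c ≤ B (‖v‖⁻¹ • v) (‖v‖⁻¹ • v) := hmin (by simp [norm_smul, hn.ne'])
  simp only [map_smul, smul_apply, smul_eq_mul] at h1
  apply Real.le_sqrt_of_sq_le
  rw [le_div_iff₀ hc]
  have h2 : c * ‖v‖ ^ 2 ≤ B v v := by
    calc c * ‖v‖ ^ 2 ≤ (‖v‖⁻¹ * (‖v‖⁻¹ * B v v)) * ‖v‖ ^ 2 := by gcongr
      _ = B v v := by field_simp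
  linarith

/-- The smooth Riemannian metric on the open submanifold `U` of `E` given by a smooth family of
symmetric positive definite bilinear forms on `E`. -/
noncomputable def opensRiemannianMetric [FiniteDimensional ℝ E] (g : U → E →L[ℝ] E →L[ℝ] ℝ)
    (symm : ∀ x v w, g x v w = g x w v) (pos : ∀ x v, v ≠ 0 → 0 < g x v v)
    (smooth : ContMDiff 𝓘(ℝ, E) 𝓘(ℝ, E →L[ℝ] E →L[ℝ] ℝ) ∞ g) :
    Bundle.ContMDiffRiemannianMetric 𝓘(ℝ, E) ∞ E (fun x : U ↦ TangentSpace 𝓘(ℝ, E) x) where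
  inner := toTangentForm g
  symm := symm
  pos := pos
  isVonNBounded x := isVonNBounded_of_posDef_form (g x) (pos x)
  contMDiff := contMDiff_toTangentForm g smooth

/-- The Riemannian distance (infimum of the lengths of `C^1` paths) of a Riemannian metric on the
open submanifold `U` of `E`; it is `∞` between different connected components. -/
noncomputable def riemannianDistance
    (g : Bundle.ContMDiffRiemannianMetric 𝓘(ℝ, E) ∞ E (fun x : U ↦ TangentSpace 𝓘(ℝ, E) x))
    (x y : U) : ℝ≥0∞ :=
  letI : Bundle.RiemannianBundle (fun x : U ↦ TangentSpace 𝓘(ℝ, E) x) := ⟨g.toRiemannianMetric⟩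
  Manifold.riemannianEDist 𝓘(ℝ, E) x y

end OpenSubmanifold

section Matrices

/-! ### The manifolds of symmetric positive definite and of invertible matrices

Mathlib puts no norm on matrices by default, so the two vector spaces below are type synonyms that
carry the Frobenius norm. -/

/-- The vector space of real symmetric `n × n` matrices. -/
def SymMat (n : ℕ) : Type := selfAdjoint.submodule ℝ (Matrix (Fin n) (Fin n) ℝ)

/-- The vector space of all real `n × n` matrices. -/
def GenMat (n : ℕ) : Type := Matrix (Fin n) (Fin n) ℝ

section Norms

open scoped Matrix.Norms.Frobenius

noncomputable instance (n : ℕ) : NormedAddCommGroup (SymMat n) :=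
  inferInstanceAs (NormedAddCommGroup (selfAdjoint.submodule ℝ (Matrix (Fin n) (Fin n) ℝ)))

noncomputable instance (n : ℕ) : NormedSpace ℝ (SymMat n) :=
  inferInstanceAs (NormedSpace ℝ (selfAdjoint.submodule ℝ (Matrix (Fin n) (Fin n) ℝ)))

instance (n : ℕ) : FiniteDimensional ℝ (SymMat n) :=
  inferInstanceAs (FiniteDimensional ℝ (selfAdjoint.submodule ℝ (Matrix (Fin n) (Fin n) ℝ)))

noncomputable instance (n : ℕ) : NormedAddCommGroup (GenMat n) :=
  inferInstanceAs (NormedAddCommGroup (Matrix (Fin n) (Fin n) ℝ))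

noncomputable instance (n : ℕ) : NormedSpace ℝ (GenMat n) :=
  inferInstanceAs (NormedSpace ℝ (Matrix (Fin n) (Fin n) ℝ))

instance (n : ℕ) : FiniteDimensional ℝ (GenMat n) :=
  inferInstanceAs (FiniteDimensional ℝ (Matrix (Fin n) (Fin n) ℝ))

end Norms

/-- The matrix underlying an element of `SymMat n`. -/
def SymMat.mat {n : ℕ} (S : SymMat n) : Matrix (Fin n) (Fin n) ℝ := Subtype.val S

/-- The element of `SymMat n` given by a symmetric matrix. -/
def SymMat.mk {n : ℕ} (A : Matrix (Fin n) (Fin n) ℝ) (hA : A.transpose = A) : SymMat n :=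
  ⟨A, hA⟩

/-- The matrix underlying an element of `GenMat n`. -/
def GenMat.mat {n : ℕ} (P : GenMat n) : Matrix (Fin n) (Fin n) ℝ := P

theorem SymMat.ext {n : ℕ} {S T : SymMat n} (h : S.mat = T.mat) : S = T := Subtype.ext h

theorem SymMat.transpose_mat {n : ℕ} (S : SymMat n) : S.mat.transpose = S.mat := S.2

theorem SymMat.mat_mk {n : ℕ} (A : Matrix (Fin n) (Fin n) ℝ) (hA : A.transpose = A) :
    (SymMat.mk A hA).mat = A := rfl

theorem SymMat.mat_zero {n : ℕ} : (0 : SymMat n).mat = 0 := rfl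

theorem SymMat.mat_add {n : ℕ} (S T : SymMat n) : (S + T).mat = S.mat + T.mat := rfl

theorem SymMat.mat_smul {n : ℕ} (c : ℝ) (S : SymMat n) : (c • S).mat = c • S.mat := rfl

theorem GenMat.mat_add {n : ℕ} (P Q : GenMat n) : (P + Q).mat = P.mat + Q.mat := rfl

theorem GenMat.mat_smul {n : ℕ} (c : ℝ) (P : GenMat n) : (c • P).mat = c • P.mat := rfl

theorem SymMat.continuous_mat (n : ℕ) : Continuous (SymMat.mat : SymMat n → _) :=
  LinearMap.continuous_of_finiteDimensional
    ({ toFun := SymMat.mat, map_add' := SymMat.mat_add, map_smul' := SymMat.mat_smul } :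
      SymMat n →ₗ[ℝ] Matrix (Fin n) (Fin n) ℝ)

theorem GenMat.continuous_mat (n : ℕ) : Continuous (GenMat.mat : GenMat n → _) :=
  LinearMap.continuous_of_finiteDimensional
    ({ toFun := GenMat.mat, map_add' := GenMat.mat_add, map_smul' := GenMat.mat_smul } :
      GenMat n →ₗ[ℝ] Matrix (Fin n) (Fin n) ℝ)

theorem isOpen_posDef (n : ℕ) : IsOpen {X : SymMat n | X.mat.PosDef} := by
  have key : {X : SymMat n | X.mat.PosDef} =
      {X : SymMat n | ∀ v ∈ Metric.sphere (0 : Fin n → ℝ) 1, 0 < v ⬝ᵥ (X.mat.mulVec v)} := by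
    ext X
    constructor
    · intro (h : X.mat.PosDef) v hv
      have hv0 : v ≠ 0 := by rintro rfl; simp at hv
      simpa using h.dotProduct_mulVec_pos hv0
    · intro h
      refine Matrix.posDef_iff_dotProduct_mulVec.2 ⟨X.2, fun {v} hv => ?_⟩
      have hn : 0 < ‖v‖ := norm_pos_iff.2 hv
      have h1 := h (‖v‖⁻¹ • v) (by simp [norm_smul, hn.ne'])
      simp only [Matrix.mulVec_smul, dotProduct_smul, smul_dotProduct, smul_eq_mul] at h1
      have hi := inv_pos.2 hn
      have h2 := (mul_pos_iff_of_pos_left hi).1 ((mul_pos_iff_of_pos_left hi).1 h1)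
      simpa using h2
  rw [key, isOpen_iff_eventually]
  intro X hX
  refine (isCompact_sphere (0 : Fin n → ℝ) 1).eventually_forall_of_forall_eventually
    fun v hv => ?_
  have hc : Continuous fun p : SymMat n × (Fin n → ℝ) => p.2 ⬝ᵥ (p.1.mat.mulVec p.2) :=
    continuous_snd.dotProduct
      (((SymMat.continuous_mat n).comp continuous_fst).matrix_mulVec continuous_snd)
  exact hc.continuousAt.eventually (lt_mem_nhds (hX v hv))

theorem isOpen_isUnit_mat (n : ℕ) : IsOpen {P : GenMat n | IsUnit P.mat} := by
  have key : {P : GenMat n | IsUnit P.mat} = {P : GenMat n | P.mat.det ≠ 0} := by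
    ext P
    exact (Matrix.isUnit_iff_isUnit_det _).trans isUnit_iff_ne_zero
  rw [key]
  exact isOpen_ne_fun (GenMat.continuous_mat n).matrix_det continuous_const

/-- The manifold of symmetric positive definite `n × n` matrices, an open submanifold of the space
of symmetric matrices. -/
def SPD (n : ℕ) : TopologicalSpace.Opens (SymMat n) :=
  ⟨{X | X.mat.PosDef}, isOpen_posDef n⟩

/-- The manifold `GL(n)` of invertible `n × n` matrices, an open submanifold of the space of all
matrices. -/
def GLMat (n : ℕ) : TopologicalSpace.Opens (GenMat n) :=
  ⟨{P | IsUnit P.mat}, isOpen_isUnit_mat n⟩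

theorem SPD.posDef {n : ℕ} (X : SPD n) : X.1.mat.PosDef := X.2

end Matrices

section EuclideanMetric

/-! ### The Euclidean metric on `GL(n)` -/

/-- The Euclidean inner product `⟨U, V⟩₂ = tr(Uᵀ V)` on `n × n` matrices. -/
noncomputable def euclideanForm (n : ℕ) : GenMat n →L[ℝ] GenMat n →L[ℝ] ℝ :=
  LinearMap.toContinuousLinearMap
    ((LinearMap.toContinuousLinearMap : (GenMat n →ₗ[ℝ] ℝ) ≃ₗ[ℝ] _).toLinearMap ∘ₗ
      LinearMap.mk₂ ℝ (fun U V : GenMat n => (U.mat.transpose * V.mat).trace)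
        (by intros; simp [GenMat.mat_add, Matrix.add_mul]) (by intros; simp [GenMat.mat_smul])
        (by intros; simp [GenMat.mat_add, Matrix.mul_add]) (by intros; simp [GenMat.mat_smul]))

theorem euclideanForm_apply {n : ℕ} (U V : GenMat n) :
    euclideanForm n U V = (U.mat.transpose * V.mat).trace := rfl

/-- The Euclidean Riemannian metric on `GL(n)`. -/
noncomputable def glMetric (n : ℕ) :
    Bundle.ContMDiffRiemannianMetric 𝓘(ℝ, GenMat n) ∞ (GenMat n)
      (fun P : GLMat n ↦ TangentSpace 𝓘(ℝ, GenMat n) P) :=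
  opensRiemannianMetric (fun _ => euclideanForm n)
    (fun _ U V => by
      rw [euclideanForm_apply, euclideanForm_apply, ← Matrix.trace_transpose,
        Matrix.transpose_mul, Matrix.transpose_transpose])
    (fun _ U hU => by
      rw [euclideanForm_apply, ← Matrix.conjTranspose_eq_transpose_of_trivial]
      exact lt_of_le_of_ne (Matrix.posSemidef_conjTranspose_mul_self U.mat).trace_nonneg
        (fun h => hU (Matrix.trace_conjTranspose_mul_self_eq_zero_iff.1 h.symm)))
    contMDiff_const

end EuclideanMetric

section GBWMetric

/-! ### The generalized Bures-Wasserstein metric -/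

/-- The linear map `S ↦ X S M + M S X` on symmetric matrices, for symmetric `X` and `M`. -/
noncomputable def lyapunovMap {n : ℕ} (X M : SymMat n) : SymMat n →L[ℝ] SymMat n :=
  LinearMap.toContinuousLinearMap
    { toFun := fun S => SymMat.mk (X.mat * S.mat * M.mat + M.mat * S.mat * X.mat) (by
        simp only [Matrix.transpose_add, Matrix.transpose_mul, SymMat.transpose_mat]
        rw [add_comm]
        simp only [mul_assoc])
      map_add' := fun S T => by
        apply SymMat.ext
        simp only [SymMat.mat_add, SymMat.mat_mk]
        noncomm_ring
      map_smul' := fun c S => by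
        apply SymMat.ext
        simp [SymMat.mat_smul, SymMat.mat_mk] }

theorem lyapunovMap_mat {n : ℕ} (X M S : SymMat n) :
    (lyapunovMap X M S).mat = X.mat * S.mat * M.mat + M.mat * S.mat * X.mat := rfl

/-- The generalized Lyapunov operator `𝓛_{X,M}`: `𝓛_{X,M}[U]` is the symmetric solution `S` of
`X S M + M S X = U`. -/
noncomputable def lyapunovOp {n : ℕ} (X M : SymMat n) : SymMat n →L[ℝ] SymMat n :=
  (lyapunovMap X M).inverse

/-- The bilinear form `(S, T) ↦ tr(S T)` on symmetric matrices. -/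
noncomputable def symTraceForm (n : ℕ) : SymMat n →L[ℝ] SymMat n →L[ℝ] ℝ :=
  LinearMap.toContinuousLinearMap
    ((LinearMap.toContinuousLinearMap : (SymMat n →ₗ[ℝ] ℝ) ≃ₗ[ℝ] _).toLinearMap ∘ₗ
      LinearMap.mk₂ ℝ (fun S T : SymMat n => (S.mat * T.mat).trace)
        (by intros; simp [SymMat.mat_add, Matrix.add_mul]) (by intros; simp [SymMat.mat_smul])
        (by intros; simp [SymMat.mat_add, Matrix.mul_add]) (by intros; simp [SymMat.mat_smul]))

theorem symTraceForm_apply {n : ℕ} (S T : SymMat n) :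
    symTraceForm n S T = (S.mat * T.mat).trace := rfl

/-- The form `g_gbw(U, V) = (1/2) tr(𝓛_{X,M}[U] V)` on symmetric matrices. -/
noncomputable def gbwForm {n : ℕ} (M X : SPD n) : SymMat n →L[ℝ] SymMat n →L[ℝ] ℝ :=
  (1 / 2 : ℝ) • (symTraceForm n).comp (lyapunovOp X.1 M.1)

theorem gbwForm_apply {n : ℕ} (M X : SPD n) (U V : SymMat n) :
    gbwForm M X U V = 1 / 2 * ((lyapunovOp X.1 M.1 U).mat * V.mat).trace := rfl

theorem trace_mul_lyapunovMap {n : ℕ} (X M S T : SymMat n) :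
    (S.mat * (lyapunovMap X M T).mat).trace = ((lyapunovMap X M S).mat * T.mat).trace := by
  rw [lyapunovMap_mat, lyapunovMap_mat, mul_add, add_mul, Matrix.trace_add, Matrix.trace_add,
    add_comm]
  congr 1
  · rw [← mul_assoc, ← mul_assoc, Matrix.trace_mul_comm]
    simp only [mul_assoc]
  · rw [← mul_assoc, ← mul_assoc, Matrix.trace_mul_comm]
    simp only [mul_assoc]

theorem trace_mul_lyapunovMap_pos {n : ℕ} (X M : SPD n) (S : SymMat n) (hS : S ≠ 0) :
    0 < (S.mat * (lyapunovMap X.1 M.1 S).mat).trace := by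
  have hSs : S.mat.conjTranspose = S.mat := S.2
  have hXM : 0 < (S.mat * X.1.mat * S.mat * M.1.mat).trace := by
    obtain ⟨y, hy, hM⟩ := CStarAlgebra.isStrictlyPositive_iff_eq_star_mul_self.mp
      (SPD.posDef M).isStrictlyPositive
    obtain ⟨z, hz, hX⟩ := CStarAlgebra.isStrictlyPositive_iff_eq_star_mul_self.mp
      (SPD.posDef X).isStrictlyPositive
    change M.1.mat = _ at hM
    change X.1.mat = _ at hX
    have e : (S.mat * X.1.mat * S.mat * M.1.mat).trace =
        ((z * S.mat * y.conjTranspose).conjTranspose * (z * S.mat * y.conjTranspose)).trace := by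
      rw [hM, hX, Matrix.star_eq_conjTranspose, Matrix.star_eq_conjTranspose,
        Matrix.conjTranspose_mul, Matrix.conjTranspose_mul, Matrix.conjTranspose_conjTranspose,
        hSs]
      rw [← mul_assoc, Matrix.trace_mul_comm]
      simp only [mul_assoc]
    rw [e]
    refine lt_of_le_of_ne (Matrix.posSemidef_conjTranspose_mul_self _).trace_nonneg fun h => hS ?_
    have h0 := Matrix.trace_conjTranspose_mul_self_eq_zero_iff.1 h.symm
    have hy' : IsUnit y.conjTranspose := hy.star
    apply SymMat.ext
    rwa [hy'.mul_left_eq_zero, hz.mul_right_eq_zero] at h0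
  have e2 : (S.mat * (lyapunovMap X.1 M.1 S).mat).trace = 2 * (S.mat * X.1.mat * S.mat * M.1.mat).trace := by
    rw [lyapunovMap_mat, mul_add, Matrix.trace_add, two_mul]
    congr 1
    · simp only [mul_assoc]
    · rw [show S.mat * (M.1.mat * S.mat * X.1.mat) = (S.mat * M.1.mat) * (S.mat * X.1.mat) by
        simp only [mul_assoc], Matrix.trace_mul_comm]
      simp only [mul_assoc]
  rw [e2]
  positivity

/-- `S ↦ X S M + M S X` is invertible on symmetric matrices if `X` and `M` are positive definite. -/
theorem lyapunovMap_isInvertible {n : ℕ} (X M : SPD n) :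
    (lyapunovMap X.1 M.1).IsInvertible := by
  have hinj : Function.Injective (lyapunovMap X.1 M.1).toLinearMap := by
    rw [← LinearMap.ker_eq_bot, LinearMap.ker_eq_bot']
    intro S hS
    by_contra h
    have := trace_mul_lyapunovMap_pos X M S h
    change lyapunovMap X.1 M.1 S = 0 at hS
    simp [hS, SymMat.mat_zero] at this
  exact ⟨(LinearEquiv.ofInjectiveEndo _ hinj).toContinuousLinearEquiv, by ext1; rfl⟩

theorem lyapunovOp_spec {n : ℕ} (X M : SPD n) (U : SymMat n) :
    X.1.mat * (lyapunovOp X.1 M.1 U).mat * M.1.mat +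
      M.1.mat * (lyapunovOp X.1 M.1 U).mat * X.1.mat = U.mat := by
  obtain ⟨e, he⟩ := lyapunovMap_isInvertible X M
  have h : lyapunovMap X.1 M.1 (lyapunovOp X.1 M.1 U) = U := by
    rw [lyapunovOp, ← he, ContinuousLinearMap.inverse_equiv]
    simp
  exact congrArg SymMat.mat h

theorem lyapunovMap_lyapunovOp {n : ℕ} (X M : SPD n) (U : SymMat n) :
    lyapunovMap X.1 M.1 (lyapunovOp X.1 M.1 U) = U :=
  SymMat.ext (lyapunovOp_spec X M U)

theorem gbwForm_symm {n : ℕ} (M X : SPD n) (U V : SymMat n) :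
    gbwForm M X U V = gbwForm M X V U := by
  rw [gbwForm_apply, gbwForm_apply]
  congr 1
  conv_lhs => rw [← lyapunovMap_lyapunovOp X M V, trace_mul_lyapunovMap,
    lyapunovMap_lyapunovOp X M U, Matrix.trace_mul_comm]

theorem gbwForm_pos {n : ℕ} (M X : SPD n) (U : SymMat n) (hU : U ≠ 0) : 0 < gbwForm M X U U := by
  rw [gbwForm_apply]
  have h : lyapunovOp X.1 M.1 U ≠ 0 := fun h => hU (by
    rw [← lyapunovMap_lyapunovOp X M U, h, map_zero])
  have := trace_mul_lyapunovMap_pos X M _ h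
  rw [lyapunovMap_lyapunovOp] at this
  positivity

theorem contMDiff_gbwForm {n : ℕ} (M : SPD n) :
    ContMDiff 𝓘(ℝ, SymMat n) 𝓘(ℝ, SymMat n →L[ℝ] SymMat n →L[ℝ] ℝ) ∞ (gbwForm M) := by
  have hlin : IsLinearMap ℝ (fun X : SymMat n => lyapunovMap X M.1) := by
    constructor
    · intro X Y
      ext1 S
      apply SymMat.ext
      simp only [lyapunovMap_mat, add_apply, SymMat.mat_add]
      noncomm_ring
    · intro c X
      ext1 S
      apply SymMat.ext
      simp [lyapunovMap_mat, SymMat.mat_smul]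
  have h1 : ContDiff ℝ ∞ (fun X : SymMat n => lyapunovMap X M.1) :=
    (LinearMap.toContinuousLinearMap (hlin.mk' _)).contDiff
  have h2 : ContMDiff 𝓘(ℝ, SymMat n) 𝓘(ℝ, SymMat n →L[ℝ] SymMat n) ∞
      (fun X : SPD n => lyapunovOp X.1 M.1) := by
    intro X
    obtain ⟨e, he⟩ := lyapunovMap_isInvertible X M
    have h3 : ContDiffAt ℝ ∞ (ContinuousLinearMap.inverse ∘ fun X : SymMat n => lyapunovMap X M.1)
        X.1 := by
      refine ContDiffAt.comp _ ?_ h1.contDiffAt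
      rw [← he]
      exact contDiffAt_map_inverse e
    exact h3.contMDiffAt.comp X (contMDiff_subtype_val X)
  have h4 : ContDiff ℝ ∞ (fun L : SymMat n →L[ℝ] SymMat n =>
      (1 / 2 : ℝ) • (symTraceForm n).comp L) := by
    fun_prop
  exact h4.contMDiff.comp h2

/-- The generalized Bures-Wasserstein Riemannian metric on `SPD n` with parameter `M`. -/
noncomputable def gbwMetric {n : ℕ} (M : SPD n) :
    Bundle.ContMDiffRiemannianMetric 𝓘(ℝ, SymMat n) ∞ (SymMat n)
      (fun X : SPD n ↦ TangentSpace 𝓘(ℝ, SymMat n) X) :=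
  opensRiemannianMetric (gbwForm M) (gbwForm_symm M) (gbwForm_pos M) (contMDiff_gbwForm M)

end GBWMetric

section Distances

/-! ### The submersion `π : GL(n) → SPD n` and the closed-form distances

`CFC.sqrt A` is the positive semidefinite square root `A^{1/2}` of a positive semidefinite `A`. -/

theorem posDef_sqrt_mul_mul_transpose_mul_sqrt {n : ℕ} (M : SPD n) (P : GLMat n) :
    (CFC.sqrt M.1.mat * P.1.mat * P.1.mat.transpose * CFC.sqrt M.1.mat).PosDef := by
  have hs : (CFC.sqrt M.1.mat).PosDef := by
    have h0 : (CFC.sqrt M.1.mat).PosSemidef := 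
      Matrix.nonneg_iff_posSemidef.1 (CFC.sqrt_nonneg M.1.mat)
    rw [h0.posDef_iff_isUnit]
    have hu : IsUnit (CFC.sqrt M.1.mat * CFC.sqrt M.1.mat) := by
      rw [CFC.sqrt_mul_sqrt_self _ (SPD.posDef M).posSemidef.nonneg]
      exact (SPD.posDef M).isUnit
    exact isUnit_of_mul_isUnit_left hu
  have hA : IsUnit (CFC.sqrt M.1.mat * P.1.mat) := hs.isUnit.mul P.2
  have e : CFC.sqrt M.1.mat * P.1.mat * P.1.mat.transpose * CFC.sqrt M.1.mat =
      (CFC.sqrt M.1.mat * P.1.mat) * (CFC.sqrt M.1.mat * P.1.mat).conjTranspose := by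
    rw [Matrix.conjTranspose_mul, hs.isHermitian.eq,
      Matrix.conjTranspose_eq_transpose_of_trivial]
    simp only [mul_assoc]
  rw [e, (Matrix.posSemidef_self_mul_conjTranspose _).posDef_iff_isUnit]
  exact hA.mul hA.star

/-- The map `π : GL(n) → SPD n`, `π(P) = M^{1/2} P Pᵀ M^{1/2}`. -/
noncomputable def gbwProj {n : ℕ} (M : SPD n) (P : GLMat n) : SPD n :=
  ⟨SymMat.mk (CFC.sqrt M.1.mat * P.1.mat * P.1.mat.transpose * CFC.sqrt M.1.mat)
    (posDef_sqrt_mul_mul_transpose_mul_sqrt M P).isHermitian,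
    posDef_sqrt_mul_mul_transpose_mul_sqrt M P⟩

/-- The Bures-Wasserstein distance
`(tr A + tr B - 2 tr((A^{1/2} B A^{1/2})^{1/2}))^{1/2}` of positive definite matrices. -/
noncomputable def bwDist {n : ℕ} (A B : Matrix (Fin n) (Fin n) ℝ) : ℝ :=
  √(A.trace + B.trace - 2 * (CFC.sqrt (CFC.sqrt A * B * CFC.sqrt A)).trace)

/-- The expression `tr(M⁻¹X) + tr(M⁻¹Y) - 2 tr((X^{1/2} M⁻¹ Y M⁻¹ X^{1/2})^{1/2})`. -/
noncomputable def gbwSqDist {n : ℕ} (M X Y : Matrix (Fin n) (Fin n) ℝ) : ℝ :=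
  (M⁻¹ * X).trace + (M⁻¹ * Y).trace -
    2 * (CFC.sqrt (CFC.sqrt X * M⁻¹ * Y * M⁻¹ * CFC.sqrt X)).trace

end Distances

/-! Put `A = M^{-1/2} X M^{-1/2}` and `B = M^{-1/2} Y M^{-1/2}`. Then `π(P) = X` means `P Pᵀ = A`,
so each fibre of `π` is an orbit of the orthogonal group acting on the right. Everything is
expressed through the positive definite `T` with `T A T = B` (`exists_posDef_transport`). Both
nested square roots in the closed forms have trace `tr(T A)`, and `tr(Pᵀ Q) ≤ tr(T A)` for `P`, `Q`
over `X`, `Y`, with equality at `Q = T P`. Hence the closed form `δ(X, Y)` is the Frobenius distance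
between the two fibres, attained from every `P` over `X`. This gives the quotient formula for `‖P -
Q‖` and makes `δ` a pseudometric.

Upper bound: the segment `(1 + t (T - 1)) P` from `P` to `T P` stays in `GL(n)`, since `1 + t (T -
1)` is a convex combination of positive definite matrices. Its velocity is horizontal, so its image
under `π` has constant GBW speed `‖P - T P‖ = δ(X, Y)` (`gbwForm_transport_velocity`).

Lower bound: no path is lifted. A pseudometric that grows along each curve no faster than the
Riemannian speed is at most the Riemannian distance (`ofReal_le_riemannianDistance`). For `δ` the
growth estimate comes from writing `Y` near `X` as `(1 + M S) X (1 + S M)`: then `δ(X, Y)² ≤ tr(S X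
S M)`, and `S` is `𝓛_{X,M}[Y - X]` to first order (`exists_local_transport`). -/

section Lengths

/-! ### Lengths of curves in an open submanifold -/

open MeasureTheory Set

variable {E : Type*} [NormedAddCommGroup E] [NormedSpace ℝ E] {U : TopologicalSpace.Opens E}

/-- A curve in an open submanifold is `C^1` iff it is `C^1` as a curve in the vector space. -/
theorem contMDiffOn_opens_iff {γ : ℝ → U} {s : Set ℝ} :
    ContMDiffOn 𝓘(ℝ, ℝ) 𝓘(ℝ, E) 1 γ s ↔ ContDiffOn ℝ 1 (fun t => (γ t : E)) s := by
  rw [← contMDiffOn_iff_contDiffOn]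
  constructor
  · intro h
    exact (contMDiff_subtype_val (I := 𝓘(ℝ, E)) (n := 1)).comp_contMDiffOn h
  · intro h
    rw [contMDiffOn_iff_target]
    refine ⟨continuousOn_iff_continuous_domRestrict.2 ?_, fun y => ?_⟩
    · exact Topology.IsInducing.subtypeVal.continuous_iff.2
        (continuousOn_iff_continuous_domRestrict.1 h.continuousOn)
    · refine ContMDiffOn.congr (h.mono inter_subset_left) fun t _ => ?_
      rfl

theorem mfderivWithin_opens {γ : ℝ → U} {s : Set ℝ} {t : ℝ}
    (h : MDifferentiableWithinAt 𝓘(ℝ, ℝ) 𝓘(ℝ, E) γ s t) :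
    mfderivWithin 𝓘(ℝ, ℝ) 𝓘(ℝ, E) γ s t (1 : ℝ) = derivWithin (fun t => (γ t : E)) s t := by
  have e : mfderivWithin 𝓘(ℝ, ℝ) 𝓘(ℝ, E) γ s t = fderivWithin ℝ
      (writtenInExtChartAt 𝓘(ℝ, ℝ) 𝓘(ℝ, E) t γ)
      ((extChartAt 𝓘(ℝ, ℝ) t).symm ⁻¹' s ∩ range 𝓘(ℝ, ℝ)) (extChartAt 𝓘(ℝ, ℝ) t t) := if_pos h
  refine (congrArg (fun L : ℝ →L[ℝ] E => L 1) e).trans ?_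
  simp only [mfld_simps, inter_univ]
  exact fderivWithin_derivWithin

variable [FiniteDimensional ℝ E]

theorem exists_path_of_riemannianDistance_lt (g : U → E →L[ℝ] E →L[ℝ] ℝ)
    (symm : ∀ x v w, g x v w = g x w v) (pos : ∀ x v, v ≠ 0 → 0 < g x v v)
    (smooth : ContMDiff 𝓘(ℝ, E) 𝓘(ℝ, E →L[ℝ] E →L[ℝ] ℝ) ∞ g) {x y : U} {r : ℝ≥0∞}
    (hr : riemannianDistance (opensRiemannianMetric g symm pos smooth) x y < r) :
    ∃ γ : ℝ → U, γ 0 = x ∧ γ 1 = y ∧ ContDiffOn ℝ 1 (fun t => (γ t : E)) (Icc 0 1) ∧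
      ∫⁻ t in Icc (0 : ℝ) 1, ENNReal.ofReal √(g (γ t) (derivWithin (fun t => (γ t : E)) (Icc 0 1) t)
        (derivWithin (fun t => (γ t : E)) (Icc 0 1) t)) < r := by
  let _ : Bundle.RiemannianBundle (fun x : U ↦ TangentSpace 𝓘(ℝ, E) x) :=
    ⟨(opensRiemannianMetric g symm pos smooth).toRiemannianMetric⟩
  obtain ⟨γ, h0, h1, hγ, hl⟩ := Manifold.exists_lt_of_riemannianEDist_lt hr
  refine ⟨γ, h0, h1, contMDiffOn_opens_iff.1 hγ, ?_⟩
  rw [Manifold.pathELength_eq_lintegral_mfderivWithin_Icc] at hl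
  convert hl using 1
  refine setLIntegral_congr_fun measurableSet_Icc fun t ht => ?_
  rw [← ofReal_norm, norm_eq_sqrt_real_inner, ← mfderivWithin_opens (hγ.mdifferentiableOn one_ne_zero t ht)]
  rfl

theorem riemannianDistance_le_of_constant_speed (g : U → E →L[ℝ] E →L[ℝ] ℝ)
    (symm : ∀ x v w, g x v w = g x w v) (pos : ∀ x v, v ≠ 0 → 0 < g x v v)
    (smooth : ContMDiff 𝓘(ℝ, E) 𝓘(ℝ, E →L[ℝ] E →L[ℝ] ℝ) ∞ g) {x y : U} {γ : ℝ → U} {r : ℝ}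
    {v : ℝ → E} (h0 : γ 0 = x) (h1 : γ 1 = y)
    (hγ : ContDiffOn ℝ 1 (fun t => (γ t : E)) (Icc 0 1))
    (hv : ∀ t ∈ Icc (0 : ℝ) 1, HasDerivWithinAt (fun t => (γ t : E)) (v t) (Icc 0 1) t)
    (hs : ∀ t ∈ Icc (0 : ℝ) 1, √(g (γ t) (v t) (v t)) ≤ r) :
    riemannianDistance (opensRiemannianMetric g symm pos smooth) x y ≤ ENNReal.ofReal r := by
  let _ : Bundle.RiemannianBundle (fun x : U ↦ TangentSpace 𝓘(ℝ, E) x) :=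
    ⟨(opensRiemannianMetric g symm pos smooth).toRiemannianMetric⟩
  have hγ' := contMDiffOn_opens_iff.2 hγ
  refine (Manifold.riemannianEDist_le_pathELength hγ' h0 h1 zero_le_one).trans ?_
  rw [Manifold.pathELength_eq_lintegral_mfderivWithin_Icc]
  have : ENNReal.ofReal r = ∫⁻ t in Icc (0 : ℝ) 1, ENNReal.ofReal r := by simp
  rw [this]
  refine setLIntegral_mono' measurableSet_Icc fun t ht => ?_
  rw [← ofReal_norm, norm_eq_sqrt_real_inner]
  refine ENNReal.ofReal_le_ofReal (le_trans (le_of_eq ?_) (hs t ht))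
  have e := (mfderivWithin_opens (hγ'.mdifferentiableOn one_ne_zero t ht)).trans
    ((hv t ht).derivWithin (uniqueDiffOn_Icc zero_lt_one t ht))
  exact congrArg (fun w : E => √(g (γ t) w w)) e

/-- A pseudometric `D` on `U` whose infinitesimal growth along every curve is at most the norm of
the velocity is at most the Riemannian distance. -/
theorem ofReal_le_riemannianDistance (g : U → E →L[ℝ] E →L[ℝ] ℝ)
    (symm : ∀ x v w, g x v w = g x w v) (pos : ∀ x v, v ≠ 0 → 0 < g x v v)
    (smooth : ContMDiff 𝓘(ℝ, E) 𝓘(ℝ, E →L[ℝ] E →L[ℝ] ℝ) ∞ g) (D : U → U → ℝ)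
    (self : ∀ x, D x x = 0) (comm : ∀ x y, D x y = D y x)
    (triangle : ∀ x y z, D x z ≤ D x y + D y z)
    (cont : ∀ x, Filter.Tendsto (D x) (nhds x) (nhds 0))
    (speed : ∀ (γ : ℝ → U) (t : ℝ) (v : E) (r : ℝ),
      HasDerivWithinAt (fun t => (γ t : E)) v (Ioi t) t → √(g (γ t) v v) < r →
      ∀ᶠ s in nhdsWithin t (Ioi t), D (γ t) (γ s) < r * (s - t)) (x y : U) :
    ENNReal.ofReal (D x y) ≤ riemannianDistance (opensRiemannianMetric g symm pos smooth) x y := by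
  refine le_of_forall_gt fun r hr => ?_
  obtain ⟨γ, h0, h1, hγ, hl⟩ := exists_path_of_riemannianDistance_lt g symm pos smooth hr
  refine lt_of_le_of_lt ?_ hl
  set c : ℝ → E := fun t => (γ t : E) with hc
  have hγc : ContinuousOn γ (Icc 0 1) := continuousOn_iff_continuous_domRestrict.2
    (Topology.IsInducing.subtypeVal.continuous_iff.2
      (continuousOn_iff_continuous_domRestrict.1 hγ.continuousOn))
  have hd : ContinuousOn (derivWithin c (Icc 0 1)) (Icc 0 1) :=
    hγ.continuousOn_derivWithin (uniqueDiffOn_Icc zero_lt_one) le_rfl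
  set f : ℝ → ℝ := fun t => √(g (γ t) (derivWithin c (Icc 0 1) t) (derivWithin c (Icc 0 1) t))
    with hf
  have hfc : ContinuousOn f (Icc 0 1) :=
    (((smooth.continuous.comp_continuousOn hγc).clm_apply hd).clm_apply hd).sqrt
  -- Extending the speed by constants beyond `[0, 1]` makes it continuous on the line, so its
  -- primitive has a two-sided derivative at the endpoints too.
  set F : ℝ → ℝ := IccExtend (zero_le_one (α := ℝ)) ((Icc (0 : ℝ) 1).domRestrict f) with hF
  have hFc : Continuous F := (continuousOn_iff_continuous_domRestrict.1 hfc).Icc_extend'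
  have hFf : ∀ t ∈ Icc (0 : ℝ) 1, F t = f t := fun t ht => IccExtend_of_mem _ _ ht
  have hint : ∫⁻ t in Icc (0 : ℝ) 1, ENNReal.ofReal (f t) = ENNReal.ofReal (∫ t in 0..1, F t) := by
    rw [intervalIntegral.integral_of_le zero_le_one, ← integral_Icc_eq_integral_Ioc,
      ofReal_integral_eq_lintegral_ofReal (hFc.integrableOn_Icc)]
    · exact setLIntegral_congr_fun measurableSet_Icc fun t ht => by simp only [hFf t ht]
    · exact Filter.Eventually.of_forall fun t => Real.sqrt_nonneg _
  rw [hint]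
  refine ENNReal.ofReal_le_ofReal ?_
  have hDc : ContinuousOn (fun t => D x (γ t)) (Icc 0 1) := by
    intro t ht
    have h2 : Filter.Tendsto (fun s => D (γ t) (γ s)) (nhdsWithin t (Icc 0 1)) (nhds 0) :=
      (cont (γ t)).comp (hγc t ht)
    refine tendsto_iff_dist_tendsto_zero.2
      (squeeze_zero (fun _ => dist_nonneg) (fun s => ?_) h2)
    rw [Real.dist_eq, abs_le]
    have := triangle x (γ s) (γ t)
    have := triangle x (γ t) (γ s)
    have := comm (γ s) (γ t)
    constructor <;> linarith
  -- Mean value inequality against the arc length: by the triangle inequality the right slope of `D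
  -- x (γ ·)` at `t` is at most `D (γ t) (γ s) / (s - t)`, which `speed` controls.
  have key := image_le_of_liminf_slope_right_le_deriv_boundary (f := fun t => D x (γ t))
    (a := 0) (b := 1) hDc (B := fun t => ∫ u in 0..t, F u) (B' := F) (by simp [h0, self])
    ((intervalIntegral.continuous_primitive
      (fun a b => hFc.intervalIntegrable a b) 0).continuousOn)
    (fun t _ => (intervalIntegral.integral_hasDerivAt_right (hFc.intervalIntegrable _ _)
      (hFc.stronglyMeasurableAtFilter _ _) hFc.continuousAt).hasDerivWithinAt)
    (fun t ht q hq => ?_) (right_mem_Icc.2 zero_le_one)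
  · simpa [h1] using key
  · have ht' := Ico_subset_Icc_self ht
    rw [hFf t ht'] at hq
    have hder : HasDerivWithinAt c (derivWithin c (Icc 0 1) t) (Ioi t) t := by
      have := (hγ.differentiableOn one_ne_zero t ht').hasDerivWithinAt
      refine this.mono_of_mem_nhdsWithin ?_
      exact Filter.mem_of_superset (Ioc_mem_nhdsGT ht.2)
        (fun s hs => ⟨ht.1.trans hs.1.le, hs.2⟩)
    refine Filter.Eventually.frequently ?_
    filter_upwards [speed γ t _ q hder hq, self_mem_nhdsWithin] with s hs hts
    have hts' : 0 < s - t := sub_pos.2 hts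
    rw [slope_def_field, div_lt_iff₀ hts']
    have := triangle x (γ t) (γ s)
    linarith

end Lengths

/-! ### The transport matrix and the trace inequality -/

section MatrixAlgebra

open Matrix

variable {n : ℕ}

theorem Matrix.PosDef.sqrt {A : Matrix (Fin n) (Fin n) ℝ} (hA : A.PosDef) :
    (CFC.sqrt A).PosDef := by
  have h0 : (CFC.sqrt A).PosSemidef := Matrix.nonneg_iff_posSemidef.1 (CFC.sqrt_nonneg A)
  rw [h0.posDef_iff_isUnit]
  refine isUnit_of_mul_isUnit_left (y := CFC.sqrt A) ?_
  rw [CFC.sqrt_mul_sqrt_self _ hA.posSemidef.nonneg]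
  exact hA.isUnit

theorem Matrix.PosDef.sqrt_mul_sqrt {A : Matrix (Fin n) (Fin n) ℝ} (hA : A.PosDef) :
    CFC.sqrt A * CFC.sqrt A = A :=
  CFC.sqrt_mul_sqrt_self _ hA.posSemidef.nonneg

theorem Matrix.PosDef.transpose_eq {A : Matrix (Fin n) (Fin n) ℝ} (hA : A.PosDef) : Aᵀ = A :=
  hA.isHermitian

theorem Matrix.PosDef.conj_posDef {A C : Matrix (Fin n) (Fin n) ℝ} (hA : A.PosDef)
    (hC : IsUnit C) (hs : Cᵀ = C) : (C * A * C).PosDef := by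
  have h := hA.posSemidef.conjTranspose_mul_mul_same C
  rw [conjTranspose_eq_transpose_of_trivial, hs] at h
  rw [h.posDef_iff_isUnit]
  exact (hC.mul hA.isUnit).mul hC

theorem Matrix.PosDef.mul_inv_self {A : Matrix (Fin n) (Fin n) ℝ} (hA : A.PosDef) :
    A * A⁻¹ = 1 := mul_nonsing_inv _ ((isUnit_iff_isUnit_det _).1 hA.isUnit)

theorem Matrix.PosDef.inv_mul_self {A : Matrix (Fin n) (Fin n) ℝ} (hA : A.PosDef) :
    A⁻¹ * A = 1 := nonsing_inv_mul _ ((isUnit_iff_isUnit_det _).1 hA.isUnit)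

/-- The witness is `A^{-1/2} (A^{1/2} B A^{1/2})^{1/2} A^{-1/2}`, the optimal transport map between
centred Gaussians with covariances `A` and `B`. -/
theorem exists_posDef_transport {A B : Matrix (Fin n) (Fin n) ℝ} (hA : A.PosDef) (hB : B.PosDef) :
    ∃ T : Matrix (Fin n) (Fin n) ℝ, T.PosDef ∧ T * A * T = B := by
  have hs := hA.sqrt
  have hi : (CFC.sqrt A)⁻¹.PosDef := hs.inv
  have hC := hB.conj_posDef hs.isUnit hs.transpose_eq
  refine ⟨(CFC.sqrt A)⁻¹ * CFC.sqrt (CFC.sqrt A * B * CFC.sqrt A) * (CFC.sqrt A)⁻¹,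
    hC.sqrt.conj_posDef hi.isUnit hi.transpose_eq, ?_⟩
  have h1 := hs.mul_inv_self
  have h2 := hs.inv_mul_self
  have h3 := hA.sqrt_mul_sqrt
  have h4 := hC.sqrt_mul_sqrt
  generalize CFC.sqrt (CFC.sqrt A * B * CFC.sqrt A) = N at *
  generalize CFC.sqrt A = Z at *
  calc Z⁻¹ * N * Z⁻¹ * A * (Z⁻¹ * N * Z⁻¹)
      = Z⁻¹ * N * (Z⁻¹ * Z) * (Z * Z⁻¹) * N * Z⁻¹ := by rw [← h3]; simp only [mul_assoc]
    _ = Z⁻¹ * (N * N) * Z⁻¹ := by rw [h1, h2]; simp only [mul_assoc, mul_one]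
    _ = (Z⁻¹ * Z) * B * (Z * Z⁻¹) := by rw [h4]; simp only [mul_assoc]
    _ = B := by rw [h1, h2]; simp

/-- `Cᵀ T C` squares to `Cᵀ T (C Cᵀ) T C = Cᵀ B C`. Since `C` is any factor of `A`, symmetric or
not, this serves both the BW root and the GBW root. -/
theorem sqrt_transpose_mul_transport {T A B C : Matrix (Fin n) (Fin n) ℝ} (hT : T.PosDef)
    (hC : C * Cᵀ = A) (hB : T * A * T = B) : CFC.sqrt (Cᵀ * B * C) = Cᵀ * T * C := by
  have h := hT.posSemidef.conjTranspose_mul_mul_same C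
  rw [conjTranspose_eq_transpose_of_trivial] at h
  refine CFC.sqrt_unique ?_ h.nonneg
  rw [← hB, ← hC]
  simp only [mul_assoc]

/-- With `S = yᵀ y`, expand `0 ≤ ‖y - y W‖²`; both squared norms equal `tr S`. -/
theorem trace_mul_le_of_mul_transpose_eq_one {S W : Matrix (Fin n) (Fin n) ℝ}
    (hS : S.PosSemidef) (hW : W * Wᵀ = 1) : (S * W).trace ≤ S.trace := by
  obtain ⟨y, rfl⟩ := CStarAlgebra.nonneg_iff_eq_star_mul_self.1 hS.nonneg
  rw [star_eq_conjTranspose, conjTranspose_eq_transpose_of_trivial]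
  have h := (posSemidef_conjTranspose_mul_self (y - y * W)).trace_nonneg
  rw [conjTranspose_eq_transpose_of_trivial, transpose_sub, transpose_mul, sub_mul, mul_sub,
    mul_sub, trace_sub, trace_sub, trace_sub] at h
  have e1 : (Wᵀ * yᵀ * (y * W)).trace = (yᵀ * y).trace := by
    rw [mul_assoc, trace_mul_comm]
    simp only [mul_assoc, hW, mul_one]
  have e2 : (Wᵀ * yᵀ * y).trace = (yᵀ * y * W).trace := by
    rw [← trace_transpose]
    simp only [transpose_mul, transpose_transpose, mul_assoc]
  rw [e1, e2, ← mul_assoc] at h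
  linarith

theorem trace_transpose_mul_sub_self (P Q : Matrix (Fin n) (Fin n) ℝ) :
    ((P - Q)ᵀ * (P - Q)).trace = (P * Pᵀ).trace + (Q * Qᵀ).trace - 2 * (Pᵀ * Q).trace := by
  rw [transpose_sub, sub_mul, mul_sub, mul_sub, trace_sub, trace_sub, trace_sub,
    trace_mul_comm P, trace_mul_comm Q, ← trace_transpose (Qᵀ * P), transpose_mul,
    transpose_transpose]
  ring

/-- `T P` and `Q` are both factors of `B`, so `Q = T P W` with `W` orthogonal. Then `Pᵀ Q = (Pᵀ T P)
W` with `Pᵀ T P` positive semidefinite of trace `tr(T A)`. -/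
theorem trace_transpose_mul_le {T A B P Q : Matrix (Fin n) (Fin n) ℝ} (hA : A.PosDef)
    (hT : T.PosDef) (hB : T * A * T = B) (hP : P * Pᵀ = A) (hQ : Q * Qᵀ = B) :
    (Pᵀ * Q).trace ≤ (T * A).trace := by
  have hPu : IsUnit P := isUnit_of_mul_isUnit_left (hP ▸ hA.isUnit)
  have hu : IsUnit (T * P).det := (isUnit_iff_isUnit_det _).1 (hT.isUnit.mul hPu)
  have hQ' : Q = T * P * ((T * P)⁻¹ * Q) := (mul_nonsing_inv_cancel_left _ _ hu).symm
  have hW : ((T * P)⁻¹ * Q) * ((T * P)⁻¹ * Q)ᵀ = 1 := by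
    have hu' : IsUnit ((T * P)ᵀ).det := by rwa [det_transpose]
    calc ((T * P)⁻¹ * Q) * ((T * P)⁻¹ * Q)ᵀ = (T * P)⁻¹ * (Q * Qᵀ) * ((T * P)ᵀ)⁻¹ := by
          rw [transpose_mul, transpose_nonsing_inv]; simp only [mul_assoc]
      _ = (T * P)⁻¹ * ((T * P) * (T * P)ᵀ) * ((T * P)ᵀ)⁻¹ := by
          rw [hQ, ← hB, ← hP, transpose_mul, hT.transpose_eq]; simp only [mul_assoc]
      _ = 1 := by rw [nonsing_inv_mul_cancel_left _ _ hu, mul_nonsing_inv _ hu']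
  have h := hT.posSemidef.conjTranspose_mul_mul_same P
  rw [conjTranspose_eq_transpose_of_trivial] at h
  have key := trace_mul_le_of_mul_transpose_eq_one h hW
  have e : (Pᵀ * T * P).trace = (T * A).trace := by
    rw [trace_mul_comm, ← mul_assoc, hP, trace_mul_comm]
  rw [hQ', ← e]
  simpa only [mul_assoc] using key

end MatrixAlgebra

/-! ### The closed form as a distance between fibres -/

section ClosedForm

open Matrix

variable {n : ℕ}

/-- The matrix `M^{-1/2} X M^{-1/2}`. -/
noncomputable def whiten (M X : Matrix (Fin n) (Fin n) ℝ) : Matrix (Fin n) (Fin n) ℝ :=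
  (CFC.sqrt M)⁻¹ * X * (CFC.sqrt M)⁻¹

theorem whiten_posDef (M X : SPD n) : (whiten M.1.mat X.1.mat).PosDef :=
  have hi := (SPD.posDef M).sqrt.inv
  (SPD.posDef X).conj_posDef hi.isUnit hi.transpose_eq

theorem eq_whiten_iff (M : SPD n) (A X : Matrix (Fin n) (Fin n) ℝ) :
    A = whiten M.1.mat X ↔ CFC.sqrt M.1.mat * A * CFC.sqrt M.1.mat = X := by
  have h1 := (SPD.posDef M).sqrt.mul_inv_self
  have h2 := (SPD.posDef M).sqrt.inv_mul_self
  rw [whiten]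
  generalize CFC.sqrt M.1.mat = R at *
  constructor
  · rintro rfl
    calc R * (R⁻¹ * X * R⁻¹) * R = (R * R⁻¹) * X * (R⁻¹ * R) := by simp only [mul_assoc]
      _ = X := by rw [h1, h2]; simp
  · rintro rfl
    calc A = (R⁻¹ * R) * A * (R * R⁻¹) := by rw [h1, h2]; simp
      _ = R⁻¹ * (R * A * R) * R⁻¹ := by simp only [mul_assoc]

theorem gbwProj_eq_iff (M X : SPD n) (P : GLMat n) :
    gbwProj M P = X ↔ P.1.mat * P.1.mat.transpose = whiten M.1.mat X.1.mat := by
  rw [eq_whiten_iff, ← mul_assoc]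
  exact ⟨fun h => h ▸ rfl, fun h => Subtype.ext (SymMat.ext h)⟩

theorem trace_inv_mul_eq_trace_whiten (M : SPD n) (X : Matrix (Fin n) (Fin n) ℝ) :
    ((M.1.mat)⁻¹ * X).trace = (whiten M.1.mat X).trace := by
  rw [whiten, trace_mul_cycle, ← Matrix.mul_inv_rev, (SPD.posDef M).sqrt_mul_sqrt]

theorem gbwSqDist_eq_of_transport (M X Y : SPD n) {T : Matrix (Fin n) (Fin n) ℝ} (hT : T.PosDef)
    (h : T * whiten M.1.mat X.1.mat * T = whiten M.1.mat Y.1.mat) :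
    gbwSqDist M.1.mat X.1.mat Y.1.mat = (whiten M.1.mat X.1.mat).trace +
      (whiten M.1.mat Y.1.mat).trace - 2 * (T * whiten M.1.mat X.1.mat).trace := by
  have hs := (SPD.posDef X).sqrt
  have hi := (SPD.posDef M).sqrt.inv
  -- The factor `C = M^{-1/2} X^{1/2}` of `A` is chosen so that `Cᵀ B C` is the matrix under the
  -- root in `gbwSqDist`.
  have hC : ((CFC.sqrt M.1.mat)⁻¹ * CFC.sqrt X.1.mat) *
      ((CFC.sqrt M.1.mat)⁻¹ * CFC.sqrt X.1.mat)ᵀ = whiten M.1.mat X.1.mat := by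
    rw [transpose_mul, hs.transpose_eq, hi.transpose_eq, mul_assoc,
      ← mul_assoc (CFC.sqrt X.1.mat), (SPD.posDef X).sqrt_mul_sqrt, whiten, mul_assoc]
  have e := sqrt_transpose_mul_transport hT hC h
  have e2 : CFC.sqrt X.1.mat * (M.1.mat)⁻¹ * Y.1.mat * (M.1.mat)⁻¹ * CFC.sqrt X.1.mat =
      ((CFC.sqrt M.1.mat)⁻¹ * CFC.sqrt X.1.mat)ᵀ * whiten M.1.mat Y.1.mat *
        ((CFC.sqrt M.1.mat)⁻¹ * CFC.sqrt X.1.mat) := by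
    nth_rw 1 2 [← (SPD.posDef M).sqrt_mul_sqrt]
    rw [transpose_mul, hs.transpose_eq, hi.transpose_eq, Matrix.mul_inv_rev, whiten]
    simp only [mul_assoc]
  rw [gbwSqDist, trace_inv_mul_eq_trace_whiten, trace_inv_mul_eq_trace_whiten, e2, e, mul_assoc,
    trace_mul_comm, mul_assoc, hC]

theorem bwDist_eq_of_transport {A B T : Matrix (Fin n) (Fin n) ℝ} (hA : A.PosDef) (hT : T.PosDef)
    (h : T * A * T = B) : bwDist A B = √(A.trace + B.trace - 2 * (T * A).trace) := by
  have hs := hA.sqrt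
  have hC : CFC.sqrt A * (CFC.sqrt A)ᵀ = A := by rw [hs.transpose_eq, hA.sqrt_mul_sqrt]
  have e := sqrt_transpose_mul_transport hT hC h
  rw [hs.transpose_eq] at e
  rw [bwDist, e, mul_assoc, trace_mul_comm, mul_assoc, hA.sqrt_mul_sqrt]

theorem sqrt_gbwSqDist_eq_bwDist (M X Y : SPD n) :
    √(gbwSqDist M.1.mat X.1.mat Y.1.mat) =
      bwDist (whiten M.1.mat X.1.mat) (whiten M.1.mat Y.1.mat) := by
  obtain ⟨T, hT, h⟩ := exists_posDef_transport (whiten_posDef M X) (whiten_posDef M Y)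
  rw [gbwSqDist_eq_of_transport M X Y hT h, bwDist_eq_of_transport (whiten_posDef M X) hT h]

theorem gbwSqDist_le (M X Y : SPD n) {P Q : Matrix (Fin n) (Fin n) ℝ}
    (hP : P * Pᵀ = whiten M.1.mat X.1.mat) (hQ : Q * Qᵀ = whiten M.1.mat Y.1.mat) :
    gbwSqDist M.1.mat X.1.mat Y.1.mat ≤ ((P - Q)ᵀ * (P - Q)).trace := by
  obtain ⟨T, hT, h⟩ := exists_posDef_transport (whiten_posDef M X) (whiten_posDef M Y)
  rw [gbwSqDist_eq_of_transport M X Y hT h, trace_transpose_mul_sub_self, hP, hQ]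
  have := trace_transpose_mul_le (whiten_posDef M X) hT h hP hQ
  linarith

/-- The equality case `Q = T P` of `gbwSqDist_le`. -/
theorem gbwSqDist_eq_trace (M X Y : SPD n) {P T : Matrix (Fin n) (Fin n) ℝ} (hT : T.PosDef)
    (hP : P * Pᵀ = whiten M.1.mat X.1.mat)
    (h : T * whiten M.1.mat X.1.mat * T = whiten M.1.mat Y.1.mat) :
    gbwSqDist M.1.mat X.1.mat Y.1.mat = ((P - T * P)ᵀ * (P - T * P)).trace := by
  rw [gbwSqDist_eq_of_transport M X Y hT h, trace_transpose_mul_sub_self, hP, transpose_mul,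
    hT.transpose_eq, show T * P * (Pᵀ * T) = T * (P * Pᵀ) * T by simp only [mul_assoc], hP, h,
    trace_mul_comm Pᵀ, mul_assoc, hP]

/-- The element of `GenMat n` given by a matrix. -/
def GenMat.mk (A : Matrix (Fin n) (Fin n) ℝ) : GenMat n := A

theorem GenMat.norm_eq (P : GenMat n) : ‖P‖ = √((P.matᵀ * P.mat).trace) := by
  refine (@Matrix.frobenius_norm_def (Fin n) (Fin n) ℝ _ _ _ P).trans ?_
  rw [Real.sqrt_eq_rpow]
  congr 1
  simp only [Matrix.trace, Matrix.diag, Matrix.mul_apply, Matrix.transpose_apply]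
  rw [Finset.sum_comm]
  refine Finset.sum_congr rfl fun i _ => Finset.sum_congr rfl fun j _ => ?_
  rw [Real.norm_eq_abs, Real.rpow_two, sq_abs, sq]
  rfl

theorem exists_mul_transpose_eq_whiten (M X : SPD n) :
    ∃ P : GenMat n, P.mat * P.matᵀ = whiten M.1.mat X.1.mat := by
  refine ⟨GenMat.mk (CFC.sqrt (whiten M.1.mat X.1.mat)), ?_⟩
  have h := whiten_posDef M X
  change CFC.sqrt (whiten M.1.mat X.1.mat) * (CFC.sqrt (whiten M.1.mat X.1.mat))ᵀ = _
  rw [h.sqrt.transpose_eq, h.sqrt_mul_sqrt]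

theorem gbwSqDist_nonneg (M X Y : SPD n) : 0 ≤ gbwSqDist M.1.mat X.1.mat Y.1.mat := by
  obtain ⟨P, hP⟩ := exists_mul_transpose_eq_whiten M X
  obtain ⟨T, hT, h⟩ := exists_posDef_transport (whiten_posDef M X) (whiten_posDef M Y)
  rw [gbwSqDist_eq_trace M X Y hT hP h]
  exact (posSemidef_conjTranspose_mul_self (P.mat - T * P.mat)).trace_nonneg

theorem sqrt_gbwSqDist_le (M X Y : SPD n) {P Q : GenMat n}
    (hP : P.mat * P.matᵀ = whiten M.1.mat X.1.mat) (hQ : Q.mat * Q.matᵀ = whiten M.1.mat Y.1.mat) :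
    √(gbwSqDist M.1.mat X.1.mat Y.1.mat) ≤ ‖P - Q‖ := by
  rw [GenMat.norm_eq]
  exact Real.sqrt_le_sqrt (gbwSqDist_le M X Y hP hQ)

/-- The point `P` of the fibre is prescribed, so nearest points can be chained from fibre to fibre;
the triangle inequality is then that of the norm. -/
theorem exists_norm_eq_sqrt_gbwSqDist (M X Y : SPD n) {P : GenMat n}
    (hP : P.mat * P.matᵀ = whiten M.1.mat X.1.mat) :
    ∃ Q : GenMat n, Q.mat * Q.matᵀ = whiten M.1.mat Y.1.mat ∧
      ‖P - Q‖ = √(gbwSqDist M.1.mat X.1.mat Y.1.mat) := by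
  obtain ⟨T, hT, h⟩ := exists_posDef_transport (whiten_posDef M X) (whiten_posDef M Y)
  refine ⟨GenMat.mk (T * P.mat), ?_, ?_⟩
  · change T * P.mat * (T * P.mat)ᵀ = _
    rw [transpose_mul, hT.transpose_eq, ← h, ← hP]
    simp only [mul_assoc]
  · rw [GenMat.norm_eq, gbwSqDist_eq_trace M X Y hT hP h]
    rfl

theorem sqrt_gbwSqDist_self (M X : SPD n) : √(gbwSqDist M.1.mat X.1.mat X.1.mat) = 0 := by
  obtain ⟨P, hP⟩ := exists_mul_transpose_eq_whiten M X
  refine le_antisymm ?_ (Real.sqrt_nonneg _)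
  simpa using sqrt_gbwSqDist_le M X X hP hP

theorem sqrt_gbwSqDist_comm (M X Y : SPD n) :
    √(gbwSqDist M.1.mat X.1.mat Y.1.mat) = √(gbwSqDist M.1.mat Y.1.mat X.1.mat) := by
  have key : ∀ X Y : SPD n,
      √(gbwSqDist M.1.mat X.1.mat Y.1.mat) ≤ √(gbwSqDist M.1.mat Y.1.mat X.1.mat) := by
    intro X Y
    obtain ⟨Q, hQ⟩ := exists_mul_transpose_eq_whiten M Y
    obtain ⟨P, hP, h⟩ := exists_norm_eq_sqrt_gbwSqDist M Y X hQ
    rw [← h, norm_sub_rev]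
    exact sqrt_gbwSqDist_le M X Y hP hQ
  exact le_antisymm (key X Y) (key Y X)

theorem sqrt_gbwSqDist_triangle (M X Y Z : SPD n) :
    √(gbwSqDist M.1.mat X.1.mat Z.1.mat) ≤
      √(gbwSqDist M.1.mat X.1.mat Y.1.mat) + √(gbwSqDist M.1.mat Y.1.mat Z.1.mat) := by
  obtain ⟨P, hP⟩ := exists_mul_transpose_eq_whiten M X
  obtain ⟨Q, hQ, h1⟩ := exists_norm_eq_sqrt_gbwSqDist M X Y hP
  obtain ⟨W, hW, h2⟩ := exists_norm_eq_sqrt_gbwSqDist M Y Z hQ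
  rw [← h1, ← h2]
  exact (sqrt_gbwSqDist_le M X Z hP hW).trans (norm_sub_le_norm_sub_add_norm_sub _ _ _)

end ClosedForm

/-! ### Infinitesimal growth and the lower bounds -/

section Speed

open Matrix Filter Topology Set

variable {n : ℕ}

/-- In the coordinate `S = 𝓛_{X,M}[U]` the two halves of the form agree by cyclicity of the trace,
which cancels the factor `1/2`. -/
theorem gbwForm_lyapunovMap (M X : SPD n) (S : SymMat n) :
    gbwForm M X (lyapunovMap X.1 M.1 S) (lyapunovMap X.1 M.1 S) =
      (S.mat * X.1.mat * S.mat * M.1.mat).trace := by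
  have hL : lyapunovOp X.1 M.1 (lyapunovMap X.1 M.1 S) = S := by
    obtain ⟨e, he⟩ := lyapunovMap_isInvertible X M
    rw [lyapunovOp, ← he, ContinuousLinearMap.inverse_equiv]
    simp
  rw [gbwForm_apply, hL, lyapunovMap_mat, mul_add, trace_add]
  have h1 : (S.mat * (M.1.mat * S.mat * X.1.mat)).trace =
      (S.mat * X.1.mat * S.mat * M.1.mat).trace := by
    rw [show S.mat * (M.1.mat * S.mat * X.1.mat) = (S.mat * M.1.mat) * (S.mat * X.1.mat) by
      simp only [mul_assoc], trace_mul_comm]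
    simp only [mul_assoc]
  rw [h1, ← mul_assoc, ← mul_assoc]
  ring

/-- The bilinear map whose quadratic form is `S ↦ M S X S M`. -/
noncomputable def transportForm (M X : SymMat n) : SymMat n →L[ℝ] SymMat n →L[ℝ] SymMat n :=
  LinearMap.toContinuousLinearMap
    ((LinearMap.toContinuousLinearMap : (SymMat n →ₗ[ℝ] SymMat n) ≃ₗ[ℝ] _).toLinearMap ∘ₗ
      LinearMap.mk₂ ℝ (fun S T : SymMat n => (1 / 2 : ℝ) • SymMat.mk
          (M.mat * S.mat * X.mat * T.mat * M.mat + M.mat * T.mat * X.mat * S.mat * M.mat) (by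
            simp only [transpose_add, transpose_mul, SymMat.transpose_mat]
            rw [add_comm]
            simp only [mul_assoc]))
        (by
          intros
          apply SymMat.ext
          simp only [SymMat.mat_smul, SymMat.mat_add, SymMat.mat_mk, ← smul_add]
          congr 1
          noncomm_ring)
        (by
          intros
          apply SymMat.ext
          simp [SymMat.mat_smul, SymMat.mat_mk, smul_smul, mul_comm])
        (by
          intros
          apply SymMat.ext
          simp only [SymMat.mat_smul, SymMat.mat_add, SymMat.mat_mk, ← smul_add]
          congr 1
          noncomm_ring)
        (by
          intros
          apply SymMat.ext
          simp [SymMat.mat_smul, SymMat.mat_mk, smul_smul, mul_comm]))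

theorem transportForm_self (M X S : SymMat n) :
    (transportForm M X S S).mat = M.mat * S.mat * X.mat * S.mat * M.mat := by
  change (1 / 2 : ℝ) • (M.mat * S.mat * X.mat * S.mat * M.mat +
    M.mat * S.mat * X.mat * S.mat * M.mat) = _
  rw [← two_smul ℝ, smul_smul]
  norm_num

/-- Near `X`, every positive definite `Y` is `(1 + M S) X (1 + S M)` with `S` depending
differentiably on `Y`, with derivative the generalized Lyapunov operator. -/
theorem exists_local_transport (M X : SPD n) :
    ∃ σ : SymMat n → SymMat n, σ X.1 = 0 ∧ HasFDerivAt σ (lyapunovOp X.1 M.1) X.1 ∧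
      ∀ᶠ Y in 𝓝 X.1, (1 + M.1.mat * (σ Y).mat) * X.1.mat * (1 + (σ Y).mat * M.1.mat) = Y.mat := by
  obtain ⟨e, he⟩ := lyapunovMap_isInvertible X M
  -- `F S` is `(1 + M S) X (1 + S M)` expanded. Its linear part at `0` is the invertible
  -- `lyapunovMap`, so `σ` is its local inverse.
  set F : SymMat n → SymMat n := fun S => X.1 + lyapunovMap X.1 M.1 S + transportForm M.1 X.1 S S
  have hq : HasStrictFDerivAt (fun S => transportForm M.1 X.1 S S) (0 : SymMat n →L[ℝ] SymMat n) 0 := by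
    have := ((transportForm M.1 X.1).hasStrictFDerivAt (x := 0)).clm_apply
      (hasStrictFDerivAt_id (𝕜 := ℝ) (0 : SymMat n))
    simpa using this
  have hF : HasStrictFDerivAt F (e : SymMat n →L[ℝ] SymMat n) 0 := by
    have := ((hasStrictFDerivAt_const X.1 (0 : SymMat n)).add
      (lyapunovMap X.1 M.1).hasStrictFDerivAt).add hq
    rw [zero_add, add_zero] at this
    rwa [he]
  have hF0 : F 0 = X.1 := by simp [F]
  refine ⟨hF.localInverse F e 0, ?_, ?_, ?_⟩
  · have := hF.localInverse_apply_image
    rwa [hF0] at this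
  · have := hF.to_localInverse.hasFDerivAt
    rwa [hF0, show (e.symm : SymMat n →L[ℝ] SymMat n) = lyapunovOp X.1 M.1 by
      rw [lyapunovOp, ← he, ContinuousLinearMap.inverse_equiv]] at this
  · have := hF.eventually_right_inverse
    rw [hF0] at this
    filter_upwards [this] with Y hY
    conv_rhs => rw [← hY]
    simp only [F, SymMat.mat_add, lyapunovMap_mat, transportForm_self]
    noncomm_ring

/-- For `P` over `X`, the point `Q = (1 + M^{1/2} S M^{1/2}) P` lies over `Y`, and `‖P - Q‖²` is the
right-hand side. -/
theorem gbwSqDist_le_of_transport (M X Y : SPD n) (S : SymMat n)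
    (h : (1 + M.1.mat * S.mat) * X.1.mat * (1 + S.mat * M.1.mat) = Y.1.mat) :
    gbwSqDist M.1.mat X.1.mat Y.1.mat ≤ (S.mat * X.1.mat * S.mat * M.1.mat).trace := by
  obtain ⟨P, hP⟩ := exists_mul_transpose_eq_whiten M X
  have hX := (eq_whiten_iff M _ _).1 hP
  have hR := (SPD.posDef M).sqrt.transpose_eq
  have hM := (SPD.posDef M).sqrt_mul_sqrt
  have hS := S.transpose_mat
  have key := gbwSqDist_le M X Y (Q := (1 + CFC.sqrt M.1.mat * S.mat * CFC.sqrt M.1.mat) * P.mat) hP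
    (by
      rw [eq_whiten_iff, ← h, ← hX]
      generalize CFC.sqrt M.1.mat = R at *
      rw [← hM, transpose_mul, transpose_add, transpose_mul, transpose_mul, hR, hS, transpose_one]
      noncomm_ring)
  refine key.trans (le_of_eq ?_)
  rw [← hX]
  generalize CFC.sqrt M.1.mat = R at *
  have e : P.mat - (1 + R * S.mat * R) * P.mat = -(R * S.mat * R * P.mat) := by noncomm_ring
  rw [e, transpose_neg, neg_mul_neg, ← hM, transpose_mul, transpose_mul, transpose_mul, hR, hS,
    trace_mul_comm,
    show R * S.mat * R * P.mat * (P.matᵀ * (R * (S.mat * R))) =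
      R * (S.mat * R * P.mat * P.matᵀ * R * S.mat * R) by simp only [mul_assoc], trace_mul_comm]
  simp only [mul_assoc]

theorem continuous_trace_transport (M X : SPD n) :
    Continuous fun S : SymMat n => (S.mat * X.1.mat * S.mat * M.1.mat).trace := by
  have := SymMat.continuous_mat n
  fun_prop

theorem tendsto_sqrt_gbwSqDist (M X : SPD n) :
    Tendsto (fun Y : SPD n => √(gbwSqDist M.1.mat X.1.mat Y.1.mat)) (𝓝 X) (𝓝 0) := by
  obtain ⟨σ, h0, hd, hσ⟩ := exists_local_transport M X
  have hc : Tendsto (fun Y : SPD n => (Y : SymMat n)) (𝓝 X) (𝓝 X.1) :=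
    continuous_subtype_val.continuousAt
  have h1 : Tendsto (fun Y : SPD n => √((σ Y.1).mat * X.1.mat * (σ Y.1).mat * M.1.mat).trace)
      (𝓝 X) (𝓝 0) := by
    have := ((continuous_trace_transport M X).sqrt.tendsto _).comp
      (hd.continuousAt.tendsto.comp hc)
    simpa [h0, SymMat.mat_zero, Function.comp_def] using this
  refine squeeze_zero' (Eventually.of_forall fun _ => Real.sqrt_nonneg _) ?_ h1
  filter_upwards [hc.eventually hσ] with Y hY
  exact Real.sqrt_le_sqrt (gbwSqDist_le_of_transport M X Y _ hY)

theorem eventually_sqrt_gbwSqDist_lt (M : SPD n) (γ : ℝ → SPD n) (t : ℝ) (v : SymMat n) (r : ℝ)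
    (hγ : HasDerivWithinAt (fun t => (γ t : SymMat n)) v (Ioi t) t)
    (hr : √(gbwForm M (γ t) v v) < r) :
    ∀ᶠ s in 𝓝[>] t, √(gbwSqDist M.1.mat (γ t).1.mat (γ s).1.mat) < r * (s - t) := by
  obtain ⟨σ, h0, hd, hσ⟩ := exists_local_transport M (γ t)
  have hder : HasDerivWithinAt (fun s => σ (γ s)) (lyapunovOp (γ t).1 M.1 v) (Ioi t) t :=
    hd.comp_hasDerivWithinAt t hγ
  rw [hasDerivWithinAt_iff_tendsto_slope' self_notMem_Ioi] at hder
  -- As `σ (γ t) = 0`, the slopes of `σ ∘ γ` tend to `𝓛[v]`, where the root of the trace is the GBW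
  -- norm of `v`. That root is homogeneous of degree one, so `s - t` factors out below.
  have hlim := ((continuous_trace_transport M (γ t)).sqrt.tendsto _).comp hder
  rw [← gbwForm_lyapunovMap, lyapunovMap_lyapunovOp] at hlim
  filter_upwards [hlim.eventually (gt_mem_nhds hr), self_mem_nhdsWithin,
    hγ.continuousWithinAt.eventually hσ] with s hs hts hY
  have hts' : 0 < s - t := sub_pos.2 hts
  refine (Real.sqrt_le_sqrt (gbwSqDist_le_of_transport M (γ t) (γ s) _ hY)).trans_lt ?_
  have e : √((σ (γ s)).mat * (γ t).1.mat * (σ (γ s)).mat * M.1.mat).trace =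
      √((slope (fun s => σ (γ s)) t s).mat * (γ t).1.mat * (slope (fun s => σ (γ s)) t s).mat *
        M.1.mat).trace * (s - t) := by
    have h1 : σ (γ s) = (s - t) • slope (fun s => σ (γ s)) t s := by
      rw [sub_smul_slope, h0, vsub_eq_sub, sub_zero]
    conv_lhs => rw [h1]
    simp only [SymMat.mat_smul, Matrix.mul_smul, Matrix.smul_mul, trace_smul, smul_eq_mul]
    rw [← mul_assoc, ← sq, mul_comm, Real.sqrt_mul' _ (sq_nonneg _), Real.sqrt_sq hts'.le]
  rw [e]
  exact mul_lt_mul_of_pos_right hs hts'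

theorem sqrt_gbwSqDist_le_riemannianDistance (M X Y : SPD n) :
    ENNReal.ofReal √(gbwSqDist M.1.mat X.1.mat Y.1.mat) ≤ riemannianDistance (gbwMetric M) X Y :=
  ofReal_le_riemannianDistance (gbwForm M) (gbwForm_symm M) (gbwForm_pos M) (contMDiff_gbwForm M)
    (fun X Y => √(gbwSqDist M.1.mat X.1.mat Y.1.mat)) (sqrt_gbwSqDist_self M) (sqrt_gbwSqDist_comm M) (sqrt_gbwSqDist_triangle M)
    (tendsto_sqrt_gbwSqDist M) (eventually_sqrt_gbwSqDist_lt M) X Y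

theorem sqrt_euclideanForm_self (P : GenMat n) : √(euclideanForm n P P) = ‖P‖ := by
  rw [GenMat.norm_eq, euclideanForm_apply]

theorem norm_sub_le_riemannianDistance (P Q : GLMat n) :
    ENNReal.ofReal ‖P.1 - Q.1‖ ≤ riemannianDistance (glMetric n) P Q := by
  refine ofReal_le_riemannianDistance _ _ _ _ (fun P Q : GLMat n => ‖P.1 - Q.1‖) (by simp)
    (fun P Q => norm_sub_rev _ _) (fun P Q W => norm_sub_le_norm_sub_add_norm_sub _ _ _)
    (fun P => ?_) (fun γ t v r hγ hr => ?_) P Q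
  · have : Continuous fun Q : GLMat n => ‖P.1 - Q.1‖ := by fun_prop
    simpa using this.tendsto P
  · rw [sqrt_euclideanForm_self] at hr
    rw [hasDerivWithinAt_iff_tendsto_slope' self_notMem_Ioi] at hγ
    filter_upwards [hγ.norm.eventually (gt_mem_nhds hr), self_mem_nhdsWithin] with s hs hts
    have hts' : 0 < s - t := sub_pos.2 hts
    have h1 : (γ s).1 - (γ t).1 = (s - t) • slope (fun s => (γ s).1) t s := by
      rw [sub_smul_slope, vsub_eq_sub]
    rw [norm_sub_rev, h1, norm_smul, Real.norm_of_nonneg hts'.le, mul_comm]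
    exact mul_lt_mul_of_pos_right hs hts'

end Speed

/-! ### Segments in `GL(n)`, their images, and the upper bounds -/

section Geodesics

open Matrix Set

variable {n : ℕ}

theorem posDef_one_add_smul {T : Matrix (Fin n) (Fin n) ℝ} (hT : T.PosDef) {t : ℝ}
    (ht : t ∈ Icc (0 : ℝ) 1) : (1 + t • (T - 1)).PosDef := by
  have e : 1 + t • (T - 1) = (1 - t) • (1 : Matrix (Fin n) (Fin n) ℝ) + t • T := by
    rw [smul_sub, sub_smul, one_smul]; abel
  rw [e]
  -- At `t = 0` definiteness comes from the identity; for `t > 0` it comes from `t • T`, which also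
  -- covers `t = 1`.
  rcases eq_or_lt_of_le ht.1 with rfl | h
  · simpa using PosDef.one
  · exact PosDef.posSemidef_add (PosDef.one.posSemidef.smul (sub_nonneg.2 ht.2)) (hT.smul h)

theorem riemannianDistance_gl_le {T : Matrix (Fin n) (Fin n) ℝ} (hT : T.PosDef) (P Q : GLMat n)
    (hQ : Q.1.mat = T * P.1.mat) :
    riemannianDistance (glMetric n) P Q ≤ ENNReal.ofReal ‖P.1 - Q.1‖ := by
  classical
  have hmat : ∀ t : ℝ, (P.1 + t • (Q.1 - P.1)).mat = (1 + t • (T - 1)) * P.1.mat := fun t => by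
    change P.1.mat + t • (Q.1.mat - P.1.mat) = _
    rw [hQ, add_mul, one_mul, smul_mul_assoc, sub_mul, one_mul]
  have hmem : ∀ t ∈ Icc (0 : ℝ) 1, P.1 + t • (Q.1 - P.1) ∈ GLMat n := fun t ht => by
    change IsUnit _
    rw [hmat]
    exact (posDef_one_add_smul hT ht).isUnit.mul P.2
  -- Outside `[0, 1]` the line may leave `GL(n)`; the value `P` there is arbitrary.
  let γ : ℝ → GLMat n := fun t =>
    if ht : t ∈ Icc (0 : ℝ) 1 then ⟨P.1 + t • (Q.1 - P.1), hmem t ht⟩ else P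
  have hγ : ∀ t ∈ Icc (0 : ℝ) 1, (γ t).1 = P.1 + t • (Q.1 - P.1) := fun t ht => by
    simp only [γ, dif_pos ht]
  refine riemannianDistance_le_of_constant_speed _ _ _ _ (γ := γ) (v := fun _ => Q.1 - P.1)
    (Subtype.ext ?_) (Subtype.ext ?_) ?_ ?_ ?_
  · rw [hγ 0 (left_mem_Icc.2 zero_le_one)]; simp
  · rw [hγ 1 (right_mem_Icc.2 zero_le_one)]; simp
  · refine ContDiffOn.congr (f := fun t : ℝ => P.1 + t • (Q.1 - P.1)) ?_ hγ
    fun_prop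
  · intro t ht
    refine HasDerivWithinAt.congr (f := fun t : ℝ => P.1 + t • (Q.1 - P.1)) ?_ hγ (hγ t ht)
    simpa using (((hasDerivAt_id t).smul_const (Q.1 - P.1)).const_add P.1).hasDerivWithinAt
  · intro t _
    rw [sqrt_euclideanForm_self, norm_sub_rev]

/-- With `K = 1 + t (T - 1)` and `F = T - 1`, the lifted velocity `F P = (F K⁻¹) (K P)` is
horizontal at `K P`, because `F K⁻¹` is symmetric. Its norm is therefore preserved, and does not
depend on `t`. -/
theorem gbwForm_transport_velocity (M X : SPD n) {P T : Matrix (Fin n) (Fin n) ℝ} {V : SymMat n}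
    {t : ℝ} (hT : T.PosDef) (ht : (1 + t • (T - 1)).PosDef)
    (hX : X.1.mat = CFC.sqrt M.1.mat * ((1 + t • (T - 1)) * (P * Pᵀ) * (1 + t • (T - 1))) *
      CFC.sqrt M.1.mat)
    (hV : V.mat = CFC.sqrt M.1.mat * ((T - 1) * (P * Pᵀ) * (1 + t • (T - 1)) +
      (1 + t • (T - 1)) * (P * Pᵀ) * (T - 1)) * CFC.sqrt M.1.mat) :
    gbwForm M X V V = ((P - T * P)ᵀ * (P - T * P)).trace := by
  have hM := (SPD.posDef M).sqrt_mul_sqrt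
  have hR1 := (SPD.posDef M).sqrt.mul_inv_self
  have hR2 := (SPD.posDef M).sqrt.inv_mul_self
  have hRi := (SPD.posDef M).sqrt.inv.transpose_eq
  have hK1 := ht.mul_inv_self
  have hK2 := ht.inv_mul_self
  have hKi := ht.inv.transpose_eq
  have hEt : (T - 1)ᵀ = T - 1 := by rw [transpose_sub, hT.transpose_eq, transpose_one]
  have hcomm : (T - 1) * (1 + t • (T - 1)) = (1 + t • (T - 1)) * (T - 1) := by
    rw [mul_add, add_mul, mul_one, one_mul, smul_mul_assoc, mul_smul_comm]
  have hPE : P - T * P = -((T - 1) * P) := by noncomm_ring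
  rw [hPE, transpose_neg, neg_mul_neg, transpose_mul, hEt]
  generalize 1 + t • (T - 1) = K at *
  generalize T - 1 = F at *
  have hcomm' : K⁻¹ * F = F * K⁻¹ := by
    calc K⁻¹ * F = K⁻¹ * (F * K) * K⁻¹ := by rw [mul_assoc, mul_assoc, hK1, mul_one]
      _ = F * K⁻¹ := by rw [hcomm, ← mul_assoc, hK2, one_mul]
  generalize CFC.sqrt M.1.mat = R at *
  -- This is the Lyapunov solution for `V`; it is symmetric because `K` and `F` commute.
  let S : SymMat n := SymMat.mk (R⁻¹ * (K⁻¹ * F) * R⁻¹) (by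
    rw [transpose_mul, transpose_mul, transpose_mul, hRi, hKi, hEt, ← hcomm']
    simp only [mul_assoc])
  have hS : S.mat = R⁻¹ * (K⁻¹ * F) * R⁻¹ := rfl
  have hXSM : X.1.mat * S.mat * M.1.mat = R * (K * (P * Pᵀ) * F) * R := by
    calc X.1.mat * S.mat * M.1.mat
        = R * (K * (P * Pᵀ) * K) * (R * R⁻¹) * (K⁻¹ * F) * (R⁻¹ * R) * R := by
          rw [hX, hS, ← hM]; simp only [mul_assoc]
      _ = R * (K * (P * Pᵀ) * (K * K⁻¹) * F) * R := by
          rw [hR1, hR2]; simp only [mul_assoc, mul_one]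
      _ = _ := by rw [hK1, mul_one]
  have hMSX : M.1.mat * S.mat * X.1.mat = R * (F * (P * Pᵀ) * K) * R := by
    calc M.1.mat * S.mat * X.1.mat
        = R * (R * R⁻¹) * (K⁻¹ * F) * (R⁻¹ * R) * (K * (P * Pᵀ) * K) * R := by
          rw [hX, hS, ← hM]; simp only [mul_assoc]
      _ = R * (F * (K⁻¹ * K) * (P * Pᵀ) * K) * R := by
          rw [hR1, hR2, hcomm']; simp only [mul_assoc, mul_one]
      _ = _ := by rw [hK2, mul_one]
  have hVS : V = lyapunovMap X.1 M.1 S := by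
    apply SymMat.ext
    rw [hV, lyapunovMap_mat, hXSM, hMSX]
    noncomm_ring
  rw [hVS, gbwForm_lyapunovMap, show S.mat * X.1.mat * S.mat * M.1.mat =
    S.mat * (X.1.mat * S.mat * M.1.mat) by simp only [mul_assoc], hXSM, hS]
  calc (R⁻¹ * (K⁻¹ * F) * R⁻¹ * (R * (K * (P * Pᵀ) * F) * R)).trace
      = (R⁻¹ * ((F * K⁻¹) * (R⁻¹ * R) * (K * (P * Pᵀ) * F) * R)).trace := by
        rw [hcomm']; simp only [mul_assoc]
    _ = (F * (K⁻¹ * K) * (P * Pᵀ) * F * (R * R⁻¹)).trace := by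
        rw [hR2, trace_mul_comm]; simp only [mul_assoc, mul_one]
    _ = (F * P * (Pᵀ * F)).trace := by
        rw [hK2, hR1]; simp only [mul_assoc, mul_one]
    _ = (Pᵀ * F * (F * P)).trace := trace_mul_comm _ _

theorem riemannianDistance_gbw_le (M X Y : SPD n) :
    riemannianDistance (gbwMetric M) X Y ≤
      ENNReal.ofReal √(gbwSqDist M.1.mat X.1.mat Y.1.mat) := by
  classical
  obtain ⟨P, hP⟩ := exists_mul_transpose_eq_whiten M X
  obtain ⟨T, hT, h⟩ := exists_posDef_transport (whiten_posDef M X) (whiten_posDef M Y)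
  have hR := (SPD.posDef M).sqrt
  have hEt : (T - 1)ᵀ = T - 1 := by rw [transpose_sub, hT.transpose_eq, transpose_one]
  have hPt : (P.mat * P.matᵀ)ᵀ = P.mat * P.matᵀ := by rw [transpose_mul, transpose_transpose]
  let V₁ : SymMat n := SymMat.mk (CFC.sqrt M.1.mat * ((T - 1) * (P.mat * P.matᵀ) +
      (P.mat * P.matᵀ) * (T - 1)) * CFC.sqrt M.1.mat) (by
    rw [transpose_mul, transpose_mul, transpose_add, transpose_mul, transpose_mul _ (T - 1), hEt,
      hPt, hR.transpose_eq, add_comm]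
    simp only [mul_assoc])
  let V₂ : SymMat n := SymMat.mk (CFC.sqrt M.1.mat * ((T - 1) * (P.mat * P.matᵀ) * (T - 1)) *
      CFC.sqrt M.1.mat) (by
    rw [transpose_mul, transpose_mul, transpose_mul, transpose_mul (T - 1), hEt, hPt,
      hR.transpose_eq]
    simp only [mul_assoc])
  -- The image under `π` of the segment `(1 + t (T - 1)) P`, expanded as a quadratic polynomial in
  -- `t`.
  let c : ℝ → SymMat n := fun t => X.1 + t • V₁ + t ^ 2 • V₂
  have hX := (eq_whiten_iff M _ _).1 hP
  have hmat : ∀ t : ℝ, (c t).mat = CFC.sqrt M.1.mat *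
      ((1 + t • (T - 1)) * (P.mat * P.matᵀ) * (1 + t • (T - 1))) * CFC.sqrt M.1.mat := fun t => by
    simp only [c, V₁, V₂, SymMat.mat_add, SymMat.mat_smul, SymMat.mat_mk]
    nth_rw 1 [← hX]
    simp only [add_mul, mul_add, one_mul, mul_one, smul_add, smul_mul_assoc, mul_smul_comm,
      smul_smul, ← sq]
    abel
  have hmem : ∀ t ∈ Icc (0 : ℝ) 1, c t ∈ SPD n := fun t ht => by
    change (c t).mat.PosDef
    have hK := posDef_one_add_smul hT ht
    rw [hmat, hP]
    exact ((whiten_posDef M X).conj_posDef hK.isUnit hK.transpose_eq).conj_posDef hR.isUnit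
      hR.transpose_eq
  let γ : ℝ → SPD n := fun t => if ht : t ∈ Icc (0 : ℝ) 1 then ⟨c t, hmem t ht⟩ else X
  have hγ : ∀ t ∈ Icc (0 : ℝ) 1, (γ t).1 = c t := fun t ht => by simp only [γ, dif_pos ht]
  refine riemannianDistance_le_of_constant_speed _ _ _ _ (γ := γ)
    (v := fun t => V₁ + (2 * t) • V₂) (Subtype.ext ?_) (Subtype.ext ?_) ?_ ?_ ?_
  · rw [hγ 0 (left_mem_Icc.2 zero_le_one)]; simp [c]
  · rw [hγ 1 (right_mem_Icc.2 zero_le_one)]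
    apply SymMat.ext
    rw [hmat, one_smul, add_sub_cancel, hP, h]
    exact (eq_whiten_iff M _ _).1 rfl
  · refine ContDiffOn.congr (f := c) ?_ hγ
    fun_prop
  · intro t ht
    refine HasDerivWithinAt.congr (f := c) ?_ hγ (hγ t ht)
    have := (((hasDerivAt_id t).smul_const V₁).const_add X.1).add
      ((hasDerivAt_pow 2 t).smul_const V₂)
    refine (this.congr_deriv ?_).hasDerivWithinAt
    simp
  · intro t ht
    refine le_of_eq (congrArg Real.sqrt ?_)
    rw [gbwSqDist_eq_trace M X Y hT hP h]
    refine gbwForm_transport_velocity M (γ t) hT (posDef_one_add_smul hT ht)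
      ((congrArg SymMat.mat (hγ t ht)).trans (hmat t)) ?_
    simp only [V₁, V₂, SymMat.mat_add, SymMat.mat_smul, SymMat.mat_mk]
    simp only [add_mul, mul_add, one_mul, mul_one, smul_mul_assoc, mul_smul_comm, two_mul,
      add_smul]
    abel

end Geodesics

/-! ### Equality of the distances -/

theorem riemannianDistance_gbw_eq {n : ℕ} (M X Y : SPD n) :
    riemannianDistance (gbwMetric M) X Y =
      ENNReal.ofReal √(gbwSqDist M.1.mat X.1.mat Y.1.mat) :=
  (riemannianDistance_gbw_le M X Y).antisymm (sqrt_gbwSqDist_le_riemannianDistance M X Y)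

/-- The pair `P`, `T P` attains both infima: it minimises the norm, and the segment joining it lies
in `GL(n)`. -/
theorem exists_gbwProj_eq_riemannianDistance_le {n : ℕ} (M X Y : SPD n) :
    ∃ P Q : GLMat n, gbwProj M P = X ∧ gbwProj M Q = Y ∧
      ‖P.1 - Q.1‖ = √(gbwSqDist M.1.mat X.1.mat Y.1.mat) ∧
      riemannianDistance (glMetric n) P Q ≤ ENNReal.ofReal ‖P.1 - Q.1‖ := by
  obtain ⟨P, hP⟩ := exists_mul_transpose_eq_whiten M X
  obtain ⟨T, hT, h⟩ := exists_posDef_transport (whiten_posDef M X) (whiten_posDef M Y)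
  have hPu : IsUnit P.mat := isUnit_of_mul_isUnit_left (hP ▸ (whiten_posDef M X).isUnit)
  let P' : GLMat n := ⟨P, hPu⟩
  let Q' : GLMat n := ⟨GenMat.mk (T * P.mat), hT.isUnit.mul hPu⟩
  refine ⟨P', Q', (gbwProj_eq_iff M X P').2 hP, (gbwProj_eq_iff M Y Q').2 ?_, ?_,
    riemannianDistance_gl_le hT P' Q' rfl⟩
  · change T * P.mat * (T * P.mat).transpose = _
    rw [Matrix.transpose_mul, hT.transpose_eq, ← h, ← hP]
    simp only [mul_assoc]
  · rw [GenMat.norm_eq, gbwSqDist_eq_trace M X Y hT hP h]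
    rfl

theorem mainTheorem2 (n : ℕ) (M X Y : SPD n) :
    0 ≤ gbwSqDist M.1.mat X.1.mat Y.1.mat ∧
    riemannianDistance (gbwMetric M) X Y =
      ENNReal.ofReal √(gbwSqDist M.1.mat X.1.mat Y.1.mat) ∧
    √(gbwSqDist M.1.mat X.1.mat Y.1.mat) =
      bwDist ((CFC.sqrt M.1.mat)⁻¹ * X.1.mat * (CFC.sqrt M.1.mat)⁻¹)
        ((CFC.sqrt M.1.mat)⁻¹ * Y.1.mat * (CFC.sqrt M.1.mat)⁻¹) ∧
    riemannianDistance (gbwMetric M) X Y =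
      (⨅ (P : GLMat n) (Q : GLMat n) (_ : gbwProj M P = X) (_ : gbwProj M Q = Y),
        riemannianDistance (glMetric n) P Q) ∧
    riemannianDistance (gbwMetric M) X Y =
      (⨅ (P : GLMat n) (Q : GLMat n) (_ : gbwProj M P = X) (_ : gbwProj M Q = Y),
        ENNReal.ofReal √(euclideanForm n (P.1 - Q.1) (P.1 - Q.1))) := by
  obtain ⟨P, Q, hP, hQ, hPQ, hgl⟩ := exists_gbwProj_eq_riemannianDistance_le M X Y
  have hle : ∀ P Q : GLMat n, gbwProj M P = X → gbwProj M Q = Y →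
      ENNReal.ofReal √(gbwSqDist M.1.mat X.1.mat Y.1.mat) ≤ ENNReal.ofReal ‖P.1 - Q.1‖ :=
    fun P Q hP hQ => ENNReal.ofReal_le_ofReal (sqrt_gbwSqDist_le M X Y
      ((gbwProj_eq_iff M X P).1 hP) ((gbwProj_eq_iff M Y Q).1 hQ))
  refine ⟨gbwSqDist_nonneg M X Y, riemannianDistance_gbw_eq M X Y, sqrt_gbwSqDist_eq_bwDist M X Y,
    le_antisymm ?_ ?_, le_antisymm ?_ ?_⟩ <;> rw [riemannianDistance_gbw_eq]
  · exact le_iInf₂ fun P Q => le_iInf₂ fun hP hQ =>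
      (hle P Q hP hQ).trans (norm_sub_le_riemannianDistance P Q)
  · rw [← hPQ]
    exact (iInf₂_le_of_le P Q (iInf₂_le hP hQ)).trans hgl
  · refine le_iInf₂ fun P Q => le_iInf₂ fun hP hQ => ?_
    rw [sqrt_euclideanForm_self]
    exact hle P Q hP hQ
  · rw [← hPQ, ← sqrt_euclideanForm_self]
    exact iInf₂_le_of_le P Q (iInf₂_le hP hQ)
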